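/- For $n \ge 0$ let $\mathsf{L}_2^{(n)}$ (the Toffoli ladder) be the operator on $2n+1$ qubits which acts on the computational basis states, with $x_i \in \{0,1\}$, by $$\mathsf{L}_2^{(n)} \Big(\bigotimes_{i=0}^{2n} |x_i\rangle\Big) = |x_0\rangle \otimes \bigotimes_{i=1}^{n} |x_{2i-1}\rangle\, |x_{2i} \oplus x_{2i-2}x_{2i-1}\rangle .$$ An $\mathsf{MCX}$ gate with a set $S$ of control qubits and a target qubit $t \notin S$ replaces $x_t$ by $x_t \oplus \prod_{i \in S} x_i$ and keeps all the other bits; it is a Toffoli gate if $|S| = 2$ and an $\mathsf{X}$ gate if $S = \emptyset$. The depth of a circuit is the number of time steps it needs when gates acting on disjoint sets of qubits may be performed in the same time step. There exist circuits $C_n$ ($n \ge 0$) over the gate set $\{\text{Toffoli}, \mathsf{X}\}$ such that $C_n$ acts on exactly $2n+1$ qubits (no ancilla qubits are used), $C_n$ implements $\mathsf{L}_2^{(n)}$, and, as $n \to \infty$, $C_n$ has depth $O(\log^2 n)$ and consists of $O(n \log n)$ gates. Moreover, $C_n$ can be chosen of the following form. There is a sequence of $O(\log n)$ layers of $\mathsf{MCX}$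 gates on the $2n+1$ qubits, no two gates of one layer sharing a qubit, whose composition is $\mathsf{L}_2^{(n)}$, and $C_n$ is obtained by replacing each $\mathsf{MCX}$ gate $g$ of each layer by a $\{\text{Toffoli}, \mathsf{X}\}$ circuit which implements $g$ and acts only on the qubits of $g$ and on a set of dirty ancilla qubits (qubits in an arbitrary state, which is restored), chosen among the qubits of the register that are idle in this layer; within one layer, these sets are pairwise disjoint for different gates. -/

import Mathlib

namespace QCirc

/-- The computational basis states `|x₀, …, x_{N-1}⟩` of an `N`-qubit register. -/
abbrev BasisState (N : ℕ) : Type := Fin N → Bool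

/-- Operators on the state space `(ℂ²)^{⊗N}`, as matrices in the computational basis. -/
abbrev Operator (N : ℕ) : Type := Matrix (BasisState N) (BasisState N) ℂ

/-- The operator with action `|x⟩ ↦ |f x⟩` on the computational basis states. -/
def basisOp {N : ℕ} (f : BasisState N → BasisState N) : Operator N :=
  Matrix.of fun y x => if y = f x then 1 else 0

theorem basisOp_ket {N : ℕ} (f : BasisState N → BasisState N) (x : BasisState N) :
    (basisOp f).mulVec (Pi.single x 1) = Pi.single (f x) 1 := by
  ext y
  simp [basisOp, Pi.single_apply]

/-- A multi-controlled `X` gate placed on an `N`-qubit register: the qubits it is controlled by,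
and its target qubit. -/
structure MCX (N : ℕ) where
  controls : Finset (Fin N)
  target : Fin N
  target_notMem : target ∉ controls

namespace MCX

variable {N : ℕ}

/-- The qubits on which the gate acts. -/
def support (g : MCX N) : Finset (Fin N) := insert g.target g.controls

/-- `t ↦ t ⊕ ∏ x_i` on the target, where `i` ranges over the controls; the other bits are kept. -/
def act (g : MCX N) (x : BasisState N) : BasisState N :=
  Function.update x g.target (xor (x g.target) (decide (∀ i ∈ g.controls, x i = true)))

/-- The operator of the gate on the whole register. -/
def op (g : MCX N) : Operator N := basisOp g.act

/-- Toffoli gates have two controls, `X` gates have none. -/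
def IsToffoliOrX (g : MCX N) : Prop := g.controls.card = 2 ∨ g.controls.card = 0

end MCX

/-- A circuit of `MCX` gates on exactly `N` qubits (so without ancilla qubits);
the head of the list is applied first. Its gate count is the length of the list. -/
abbrev Circuit (N : ℕ) : Type := List (MCX N)

namespace Circuit

variable {N : ℕ}

/-- The operator implemented by a circuit. -/
noncomputable def op : Circuit N → Operator N
  | [] => 1
  | g :: c => op c * g.op

/-- All the gates of the circuit are Toffoli gates and `X` gates. -/
def IsToffoliX (c : Circuit N) : Prop := ∀ g ∈ c, g.IsToffoliOrX

/-- If the qubits are busy until the times `τ`, then the gate `g` is performed in the first time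
step in which all of its qubits are free; this gives the new times. -/
def schedule (τ : Fin N → ℕ) (g : MCX N) : Fin N → ℕ :=
  fun q => if q ∈ g.support then g.support.sup τ + 1 else τ q

/-- The depth of a circuit: the number of time steps needed, when gates that act on disjoint
sets of qubits may be performed in the same time step. -/
def depth (c : Circuit N) : ℕ := Finset.univ.sup (c.foldl schedule (fun _ => 0))

/-- A layer of parallel gates: no two of them share a qubit. -/
def IsLayer (l : Circuit N) : Prop := l.Pairwise fun g h => Disjoint g.support h.support

/-- The circuit `c` realises the layer `l` over Toffoli and `X` gates, with idle qubits as dirty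
ancillae: every gate `g` of the layer is replaced by a circuit `block g` that implements `g` (for
every initial state of the remaining qubits, which it restores) and that acts only on the qubits
of `g` and on a set `anc g` of qubits on which no gate of the layer acts. Different gates use
disjoint sets of ancillae, so that the blocks can be performed in parallel. -/
def RealisesLayer (c l : Circuit N) : Prop :=
  ∃ (anc : MCX N → Finset (Fin N)) (block : MCX N → Circuit N),
    c = l.flatMap block ∧
    l.Pairwise (fun g h => Disjoint (anc g) (anc h)) ∧
    ∀ g ∈ l,
      (∀ h ∈ l, Disjoint (anc g) h.support) ∧
      (block g).IsToffoliX ∧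
      (∀ u ∈ block g, u.support ⊆ g.support ∪ anc g) ∧
      (block g).op = g.op

end Circuit

/-- The action of the Toffoli ladder on basis states of `2n+1` qubits: for `1 ≤ i ≤ n` the bit
`x_{2i}` becomes `x_{2i} ⊕ x_{2i-2} x_{2i-1}`, and the other bits are kept. -/
def ladderTwoAct (n : ℕ) (x : BasisState (2 * n + 1)) : BasisState (2 * n + 1) :=
  fun q =>
    if Even q.val ∧ 0 < q.val then
      xor (x q) (x ⟨q.val - 2, by omega⟩ && x ⟨q.val - 1, by omega⟩)
    else x q

/-- The Toffoli ladder operator `L₂^(n)`. -/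
def ladderTwo (n : ℕ) : Operator (2 * n + 1) := basisOp (ladderTwoAct n)

end QCirc

namespace QCirc

/-! Write `O(p, q)` for the product of the odd-indexed bits strictly between `p` and `q`, and let
the ladder of stride `s` send `x_q` to `x_q ⊕ x_{q-2s} O(q-2s, q)` at every positive multiple `q` of
`2s`. Stride 1 is the Toffoli ladder. To halve the number of targets, fire the rungs at `q ≡ 2s` mod
`4s`, run the ladder of stride `2s`, then fire the rungs at `q ≡ 0` mod `4s`. At such a late `q`,
with `p = q - 2s` and `r = q - 4s`, the long rung contributes `x_r O(r, p) O(p, q)`, and the last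
rung contributes `(x_p ⊕ x_r O(r, p)) O(p, q)`; their sum is the wanted `x_p O(p, q)`
(`rungLayer_strideLadder`). Unfolding gives logarithmically many layers.

It remains to realise one rung in logarithmic depth and linear size with one dirty ancilla
(`exists_block`). The point is that controls can serve as workspace: once a set `A` of controls has
been tested, flip it. If all of its bits were 1 it is now clean; otherwise the gate must not fire,
and whatever is computed there is harmless (`ComputesAnd.merge`). In `computesAnd` a clean workspace
of size `2w` tests `4w` controls, which become a workspace of twice the size, so the process ends
after logarithmically many rounds of constant depth each, while conjunction trees run in parallel
with later rounds. The first two clean qubits are themselves controls.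

A rung occupies an interval ending at its target, and targets in one layer are `4s` apart, so
supports are disjoint. For `s ≥ 2` the even qubit just before the target is idle and serves as
ancilla; for `s = 1` the rung is already a Toffoli gate. -/

theorem basisOp_mul {N : ℕ} (f g : BasisState N → BasisState N) :
    basisOp f * basisOp g = basisOp (f ∘ g) := by
  ext y x
  simp [basisOp, Matrix.mul_apply]

theorem basisOp_id {N : ℕ} : basisOp (id : BasisState N → BasisState N) = 1 := by
  ext y x
  simp [basisOp, Matrix.one_apply]

/-! ### Single gates acting on basis states -/

namespace MCX

variable {N : ℕ}

theorem target_mem_support (g : MCX N) : g.target ∈ g.support :=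
  Finset.mem_insert_self _ _

theorem act_of_ne (g : MCX N) (x : BasisState N) {q : Fin N} (h : q ≠ g.target) :
    g.act x q = x q := by
  simp [act, h]

theorem act_target (g : MCX N) (x : BasisState N) :
    g.act x g.target = xor (x g.target) (decide (∀ i ∈ g.controls, x i = true)) := by
  simp [act]

theorem act_controls (g : MCX N) (x : BasisState N) {q : Fin N} (h : q ∈ g.controls) :
    g.act x q = x q :=
  g.act_of_ne x fun e => g.target_notMem (e ▸ h)

theorem act_congr (g : MCX N) {x y : BasisState N} (h : ∀ q ∈ g.support, x q = y q) :
    ∀ q ∈ g.support, g.act x q = g.act y q := by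
  intro q hq
  by_cases e : q = g.target
  · subst e
    rw [act_target, act_target, h _ hq]
    congr 2
    refine propext (forall₂_congr fun i hi => ?_)
    rw [h i (Finset.mem_insert_of_mem hi)]
  · rw [act_of_ne _ _ e, act_of_ne _ _ e, h _ hq]

theorem act_act (g : MCX N) (x : BasisState N) : g.act (g.act x) = x := by
  ext q
  by_cases e : q = g.target
  · subst e
    have : (∀ i ∈ g.controls, g.act x i = true) ↔ ∀ i ∈ g.controls, x i = true :=
      forall₂_congr fun i hi => by rw [g.act_controls x hi]
    rw [act_target, act_target]
    simp only [this, Bool.xor_assoc, Bool.xor_self, Bool.xor_false]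
  · rw [act_of_ne _ _ e, act_of_ne _ _ e]

/-- The Toffoli gate with controls `a`, `b` and target `t`. -/
def toffoli (a b t : Fin N) (ha : t ≠ a) (hb : t ≠ b) : MCX N where
  controls := {a, b}
  target := t
  target_notMem := by simp [ha, hb]

/-- The `X` gate on the qubit `t`. -/
def not (t : Fin N) : MCX N where
  controls := ∅
  target := t
  target_notMem := by simp

theorem toffoli_act (a b t : Fin N) (ha : t ≠ a) (hb : t ≠ b) (x : BasisState N) :
    (toffoli a b t ha hb).act x = Function.update x t (xor (x t) (x a && x b)) := by
  simp [act, toffoli]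

theorem toffoli_support (a b t : Fin N) (ha : t ≠ a) (hb : t ≠ b) :
    (toffoli a b t ha hb).support = {t, a, b} := rfl

theorem toffoli_isToffoliOrX {a b t : Fin N} (ha : t ≠ a) (hb : t ≠ b) (hab : a ≠ b) :
    (toffoli a b t ha hb).IsToffoliOrX :=
  Or.inl (Finset.card_pair hab)

theorem not_act (t : Fin N) (x : BasisState N) :
    (not t).act x = Function.update x t (!x t) := by
  simp [act, not]

theorem not_isToffoliOrX (t : Fin N) : (not t).IsToffoliOrX := Or.inr rfl

end MCX

/-! ### Circuits: locality, depth and size -/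

namespace Circuit

variable {N : ℕ}

/-- The action of a circuit on the basis states. -/
def run (c : Circuit N) (x : BasisState N) : BasisState N := c.foldl (fun x g => g.act x) x

@[simp] theorem run_nil (x : BasisState N) : run [] x = x := rfl

@[simp] theorem run_cons (g : MCX N) (c : Circuit N) (x : BasisState N) :
    run (g :: c) x = run c (g.act x) := rfl

@[simp] theorem run_append (c c' : Circuit N) (x : BasisState N) :
    run (c ++ c') x = run c' (run c x) := List.foldl_append

theorem op_eq_basisOp_run (c : Circuit N) : c.op = basisOp c.run := by
  induction c with
  | nil => exact basisOp_id.symm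
  | cons g c ih =>
    rw [op, ih, MCX.op, basisOp_mul]
    rfl

theorem run_of_notMem {A : Finset (Fin N)} {c : Circuit N} (h : ∀ u ∈ c, u.support ⊆ A)
    (x : BasisState N) {q : Fin N} (hq : q ∉ A) : run c x q = x q := by
  induction c generalizing x with
  | nil => rfl
  | cons g c ih =>
    rw [run_cons, ih (fun u hu => h u (List.mem_cons_of_mem _ hu)), MCX.act_of_ne]
    rintro rfl
    exact hq (h g List.mem_cons_self g.target_mem_support)

theorem run_congr {A : Finset (Fin N)} {c : Circuit N} (h : ∀ u ∈ c, u.support ⊆ A)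
    {x y : BasisState N} (hxy : ∀ q ∈ A, x q = y q) : ∀ q ∈ A, run c x q = run c y q := by
  induction c generalizing x y with
  | nil => exact hxy
  | cons g c ih =>
    refine ih (fun u hu => h u (List.mem_cons_of_mem _ hu)) fun q hq => ?_
    by_cases hg : q ∈ g.support
    · exact g.act_congr (fun p hp => hxy p (h g List.mem_cons_self hp)) q hg
    · have : q ≠ g.target := fun e => hg (e ▸ g.target_mem_support)
      exact (g.act_of_ne x this).trans ((hxy q hq).trans (g.act_of_ne y this).symm)

theorem run_reverse_run (c : Circuit N) (x : BasisState N) : run c.reverse (run c x) = x := by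
  induction c generalizing x with
  | nil => rfl
  | cons g c ih => rw [run_cons, List.reverse_cons, run_append, ih, run_cons, run_nil, g.act_act]

theorem foldl_schedule_of_notMem {A : Finset (Fin N)} {c : Circuit N}
    (h : ∀ u ∈ c, u.support ⊆ A) (τ : Fin N → ℕ) {q : Fin N} (hq : q ∉ A) :
    c.foldl schedule τ q = τ q := by
  induction c generalizing τ with
  | nil => rfl
  | cons g c ih =>
    rw [List.foldl_cons, ih (fun u hu => h u (List.mem_cons_of_mem _ hu)), schedule,
      if_neg fun e => hq (h g List.mem_cons_self e)]

/-- On the qubits of `A`, the circuit `c` takes at most `d` time steps. -/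
def DepthLE (A : Finset (Fin N)) (d : ℕ) (c : Circuit N) : Prop :=
  ∀ (τ : Fin N → ℕ) (T : ℕ), (∀ q ∈ A, τ q ≤ T) → ∀ q ∈ A, c.foldl schedule τ q ≤ T + d

/-- The Toffoli-`X` circuit `c` acts on the qubits of `A` only, it has at most `k` gates, and both
`c` and its reverse have depth at most `d`. -/
structure Bounded (A : Finset (Fin N)) (d k : ℕ) (c : Circuit N) : Prop where
  isToffoliX : c.IsToffoliX
  support_subset : ∀ u ∈ c, u.support ⊆ A
  depthLE : DepthLE A d c
  depthLE_reverse : DepthLE A d c.reverse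
  length_le : c.length ≤ k

theorem depth_le {c : Circuit N} {d : ℕ} (h : DepthLE Finset.univ d c) : c.depth ≤ d := by
  refine Finset.sup_le fun q hq => ?_
  simpa using h (fun _ => 0) 0 (fun _ _ => le_rfl) q hq

namespace DepthLE

variable {A A' : Finset (Fin N)} {d d' : ℕ} {c c' : Circuit N}

/-- Composition works because `DepthLE` allows arbitrary starting times: the second circuit starts
from a profile bounded by `T + d`. -/
theorem append (h : DepthLE A d c) (h' : DepthLE A d' c') : DepthLE A (d + d') (c ++ c') := by
  intro τ T hτ q hq
  rw [List.foldl_append, ← add_assoc]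
  exact h' _ _ (h τ T hτ) q hq

theorem mono (hs : ∀ u ∈ c, u.support ⊆ A) (h : DepthLE A d c) (hA : A ⊆ A') (hd : d ≤ d') :
    DepthLE A' d' c := by
  intro τ T hτ q hq
  by_cases hqA : q ∈ A
  · exact (h τ T (fun p hp => hτ p (hA hp)) q hqA).trans (by omega)
  · rw [foldl_schedule_of_notMem hs τ hqA]
    exact (hτ q hq).trans (by omega)

/-- The greedy schedule of each circuit only sees its own qubits, so concatenating circuits on
disjoint sets costs no extra time. -/
theorem par (hs : ∀ u ∈ c, u.support ⊆ A) (hs' : ∀ u ∈ c', u.support ⊆ A') (hA : Disjoint A A')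
    (h : DepthLE A d c) (h' : DepthLE A' d c') : DepthLE (A ∪ A') d (c ++ c') := by
  intro τ T hτ q hq
  rw [List.foldl_append]
  by_cases hq' : q ∈ A'
  · refine h' _ T (fun p hp => ?_) q hq'
    rw [foldl_schedule_of_notMem hs τ (Finset.disjoint_right.1 hA hp)]
    exact hτ p (Finset.mem_union_right _ hp)
  · rw [foldl_schedule_of_notMem hs' _ hq']
    exact h τ T (fun p hp => hτ p (Finset.mem_union_left _ hp)) q
      ((Finset.mem_union.1 hq).resolve_right hq')

end DepthLE

namespace Bounded

variable {A A' : Finset (Fin N)} {d d' k k' : ℕ} {c c' : Circuit N}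

theorem nil (A : Finset (Fin N)) : Bounded A 0 0 [] :=
  ⟨by simp [IsToffoliX], by simp, fun _ _ h => h, fun _ _ h => h, le_rfl⟩

theorem singleton {g : MCX N} (hg : g.IsToffoliOrX) (hA : g.support ⊆ A) : Bounded A 1 1 [g] := by
  have key : DepthLE A 1 [g] := by
    intro τ T hτ q hq
    simp only [List.foldl_cons, List.foldl_nil, schedule]
    split_ifs
    · exact Nat.succ_le_succ (Finset.sup_le fun p hp => hτ p (hA hp))
    · exact (hτ q hq).trans (Nat.le_succ _)
  exact ⟨by simpa [IsToffoliX] using hg, by simpa using hA, key, key, le_rfl⟩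

theorem reverse (h : Bounded A d k c) : Bounded A d k c.reverse :=
  ⟨fun g hg => h.isToffoliX g (List.mem_reverse.1 hg),
    fun g hg => h.support_subset g (List.mem_reverse.1 hg), h.depthLE_reverse,
    by rw [List.reverse_reverse]; exact h.depthLE, by rw [List.length_reverse]; exact h.length_le⟩

theorem append (h : Bounded A d k c) (h' : Bounded A d' k' c') :
    Bounded A (d + d') (k + k') (c ++ c') where
  isToffoliX g hg := (List.mem_append.1 hg).elim (h.isToffoliX g) (h'.isToffoliX g)
  support_subset g hg := (List.mem_append.1 hg).elim (h.support_subset g) (h'.support_subset g)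
  depthLE := h.depthLE.append h'.depthLE
  depthLE_reverse := by
    rw [List.reverse_append, add_comm]
    exact h'.depthLE_reverse.append h.depthLE_reverse
  length_le := by
    rw [List.length_append]
    exact add_le_add h.length_le h'.length_le

theorem par (hA : Disjoint A A') (h : Bounded A d k c) (h' : Bounded A' d k' c') :
    Bounded (A ∪ A') d (k + k') (c ++ c') where
  isToffoliX g hg := (List.mem_append.1 hg).elim (h.isToffoliX g) (h'.isToffoliX g)
  support_subset g hg := (List.mem_append.1 hg).elim
    (fun hg => (h.support_subset g hg).trans Finset.subset_union_left)
    (fun hg => (h'.support_subset g hg).trans Finset.subset_union_right)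
  depthLE := DepthLE.par h.support_subset h'.support_subset hA h.depthLE h'.depthLE
  depthLE_reverse := by
    rw [List.reverse_append, Finset.union_comm]
    exact DepthLE.par h'.reverse.support_subset h.reverse.support_subset hA.symm
      h'.depthLE_reverse h.depthLE_reverse
  length_le := by
    rw [List.length_append]
    exact add_le_add h.length_le h'.length_le

theorem mono (h : Bounded A d k c) (hA : A ⊆ A') (hd : d ≤ d') (hk : k ≤ k') :
    Bounded A' d' k' c where
  isToffoliX := h.isToffoliX
  support_subset g hg := (h.support_subset g hg).trans hA
  depthLE := h.depthLE.mono h.support_subset hA hd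
  depthLE_reverse := h.depthLE_reverse.mono h.reverse.support_subset hA hd
  length_le := h.length_le.trans hk

theorem run_of_notMem (h : Bounded A d k c) (x : BasisState N) {q : Fin N} (hq : q ∉ A) :
    run c x q = x q :=
  Circuit.run_of_notMem h.support_subset x hq

theorem run_congr (h : Bounded A d k c) {x y : BasisState N} (hxy : ∀ q ∈ A, x q = y q) :
    ∀ q ∈ A, run c x q = run c y q :=
  Circuit.run_congr h.support_subset hxy

end Bounded

/-! ### Conjunctions in logarithmic depth with few clean qubits -/

theorem exists_flip (A : Finset (Fin N)) :
    ∃ c : Circuit N, Bounded A 1 A.card c ∧ ∀ x, ∀ q ∈ A, run c x q = !x q := by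
  induction A using Finset.induction_on with
  | empty => exact ⟨[], (Bounded.nil _).mono le_rfl (by simp) (by simp), by simp⟩
  | insert a A ha ih =>
    obtain ⟨c, hc, hrun⟩ := ih
    have hb : Bounded {a} 1 1 [MCX.not a] := .singleton (MCX.not_isToffoliOrX a) le_rfl
    refine ⟨[MCX.not a] ++ c, (hb.par (by simpa using ha) hc).mono (by simp) le_rfl
      (by rw [Finset.card_insert_of_notMem ha]; omega), fun x q hq => ?_⟩
    rw [run_append, run_cons, run_nil, MCX.not_act]
    rcases Finset.mem_insert.1 hq with e | hq
    · subst e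
      rw [hc.run_of_notMem _ ha]
      simp
    · rw [hrun _ _ hq, Function.update_of_ne]
      exact fun e => ha (e ▸ hq)

/-- A tree of Toffoli gates: the conjunction of the qubits of `S` is computed in logarithmic depth,
with clean workspace `Y`. -/
theorem exists_tree (d : ℕ) (S Y : Finset (Fin N)) (hSY : Disjoint S Y) (hS : S.Nonempty)
    (hd : S.card ≤ 2 ^ d) (hY : S.card ≤ Y.card + 1) :
    ∃ (c : Circuit N) (r : Fin N), r ∈ S ∪ Y ∧ (2 ≤ S.card → r ∈ Y) ∧
      Bounded (S ∪ Y) d (S.card - 1) c ∧ (∀ x, ∀ q ∉ Y, run c x q = x q) ∧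
      ∀ x, (∀ q ∈ Y, x q = false) → (run c x r = true ↔ ∀ q ∈ S, x q = true) := by
  induction d generalizing S Y with
  | zero =>
    have h1 : S.card = 1 := le_antisymm (by simpa using hd) hS.card_pos
    obtain ⟨s, rfl⟩ := Finset.card_eq_one.1 h1
    exact ⟨[], s, by simp, by simp, (Bounded.nil _).mono le_rfl le_rfl (by simp),
      by simp, by simp⟩
  | succ d ih =>
    by_cases hle : S.card ≤ 2 ^ d
    · obtain ⟨c, r, hr, hr', hc, h⟩ := ih S Y hSY hS hle hY
      exact ⟨c, r, hr, hr', hc.mono le_rfl (Nat.le_succ d) le_rfl, h⟩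
    have hpos : 0 < 2 ^ d := by positivity
    rw [pow_succ] at hd
    -- A binary tree with `m` leaves has `m - 1` inner nodes. The root node takes `y`, the left
    -- subtree with `2 ^ d` leaves takes `2 ^ d - 1` qubits of workspace, and the rest suffices for
    -- the right subtree, which runs in parallel.
    obtain ⟨S₁, hS₁, hc₁⟩ := Finset.exists_subset_card_eq (s := S) (n := 2 ^ d) (by omega)
    obtain ⟨y, hy⟩ : Y.Nonempty := Finset.card_pos.1 (by omega)
    have hYe : (Y.erase y).card = Y.card - 1 := Finset.card_erase_of_mem hy
    obtain ⟨Y₁, hY₁, hcY₁⟩ := Finset.exists_subset_card_eq (s := Y.erase y) (n := 2 ^ d - 1)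
      (by omega)
    have hc₂ : (S \ S₁).card = S.card - 2 ^ d := by rw [Finset.card_sdiff_of_subset hS₁, hc₁]
    have hcY₂ : (Y.erase y \ Y₁).card = Y.card - 2 ^ d := by
      rw [Finset.card_sdiff_of_subset hY₁, hcY₁]; omega
    set S₂ := S \ S₁
    set Y₂ := Y.erase y \ Y₁
    have hSm : ∀ q, q ∈ S ↔ q ∈ S₁ ∨ q ∈ S₂ := fun q => by
      rw [← Finset.mem_union, Finset.union_sdiff_of_subset hS₁]
    have hSd : ∀ q ∈ S₁, q ∉ S₂ := fun q h h' => (Finset.mem_sdiff.1 h').2 h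
    have hYm : ∀ q, q ∈ Y ↔ q = y ∨ q ∈ Y₁ ∨ q ∈ Y₂ := fun q => by
      rw [← Finset.mem_union, Finset.union_sdiff_of_subset hY₁, ← Finset.mem_insert,
        Finset.insert_erase hy]
    have hYd : ∀ q ∈ Y₁, q ∉ Y₂ := fun q h h' => (Finset.mem_sdiff.1 h').2 h
    have hy₁ : y ∉ Y₁ := fun h => Finset.notMem_erase y Y (hY₁ h)
    have hy₂ : y ∉ Y₂ := fun h => Finset.notMem_erase y Y (Finset.mem_sdiff.1 h).1
    have hd' : ∀ q ∈ S, q ∉ Y := fun _ h => Finset.disjoint_left.1 hSY h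
    have dis : ∀ q, q ∈ S₁ ∪ Y₁ → q ∉ S₂ ∪ Y₂ := by
      simp only [Finset.mem_union]
      clear * - hSm hYm hd' hSd hYd
      grind
    have hyn : y ∉ S := fun h => hd' y h hy
    clear_value S₂ Y₂
    obtain ⟨c₁, r₁, hr₁, -, hb₁, hf₁, hv₁⟩ := ih S₁ Y₁
      (Finset.disjoint_left.2 fun q h h' => hd' q ((hSm q).2 (.inl h)) ((hYm q).2 (.inr (.inl h'))))
      (Finset.card_pos.1 (by omega)) (by omega) (by omega)
    obtain ⟨c₂, r₂, hr₂, -, hb₂, hf₂, hv₂⟩ := ih S₂ Y₂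
      (Finset.disjoint_left.2 fun q h h' => hd' q ((hSm q).2 (.inr h)) ((hYm q).2 (.inr (.inr h'))))
      (Finset.card_pos.1 (by omega)) (by omega) (by omega)
    have hn₁ : y ∉ S₁ ∪ Y₁ := by
      rw [Finset.mem_union]
      exact fun h => h.elim (fun h => hyn ((hSm y).2 (.inl h))) hy₁
    have hn₂ : y ∉ S₂ ∪ Y₂ := by
      rw [Finset.mem_union]
      exact fun h => h.elim (fun h => hyn ((hSm y).2 (.inr h))) hy₂
    have e₁ : y ≠ r₁ := fun e => hn₁ (e ▸ hr₁)
    have e₂ : y ≠ r₂ := fun e => hn₂ (e ▸ hr₂)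
    have e₃ : r₁ ≠ r₂ := fun e => dis _ hr₁ (e ▸ hr₂)
    have hsub : S₁ ∪ Y₁ ∪ (S₂ ∪ Y₂) ⊆ S ∪ Y := by
      intro q
      simp only [Finset.mem_union, hSm, hYm]
      clear * -
      tauto
    have hyY : y ∈ S ∪ Y := Finset.mem_union_right _ hy
    have hb₃ : Bounded (S ∪ Y) 1 1 [MCX.toffoli r₁ r₂ y e₁ e₂] := by
      refine .singleton (MCX.toffoli_isToffoliOrX _ _ e₃) ?_
      rw [MCX.toffoli_support]
      intro q hq
      simp only [Finset.mem_insert, Finset.mem_singleton] at hq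
      rcases hq with rfl | rfl | rfl
      · exact hyY
      · exact hsub (Finset.mem_union_left _ hr₁)
      · exact hsub (Finset.mem_union_right _ hr₂)
    refine ⟨c₁ ++ c₂ ++ [MCX.toffoli r₁ r₂ y e₁ e₂], y, hyY, fun _ => hy,
      (((hb₁.par (Finset.disjoint_left.2 dis) hb₂).mono hsub le_rfl le_rfl).append hb₃).mono
        le_rfl le_rfl (by omega), fun x q hq => ?_, fun x hx => ?_⟩
    · rw [hYm, not_or, not_or] at hq
      rw [run_append, run_append, run_cons, run_nil, MCX.toffoli_act, Function.update_of_ne hq.1,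
        hf₂ _ _ hq.2.2, hf₁ _ _ hq.2.1]
    · rw [run_append, run_append, run_cons, run_nil, MCX.toffoli_act, Function.update_self,
        hb₂.run_of_notMem _ hn₂, hb₁.run_of_notMem _ hn₁, hb₂.run_of_notMem _ (dis _ hr₁),
        hx y hy, Bool.false_xor, Bool.and_eq_true,
        hv₁ x fun q hq => hx q ((hYm q).2 (.inr (.inl hq))), hv₂ (run c₁ x) fun q hq => ?_]
      · simp only [hSm, or_imp, forall_and]
        refine and_congr_right fun _ => forall₂_congr fun q hq => ?_
        rw [hb₁.run_of_notMem _ fun h => dis q h (Finset.mem_union_left _ hq)]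
      · rw [hb₁.run_of_notMem _ fun h => dis q h (Finset.mem_union_right _ hq)]
        exact hx q ((hYm q).2 (.inr (.inr hq)))

/-- The conjunction of four qubits, computed into `u`; the qubit `z` is restored. -/
theorem exists_and_four {u z a b c d : Fin N} (h : [u, z, a, b, c, d].Nodup) :
    ∃ e : Circuit N, Bounded {u, z, a, b, c, d} 6 6 e ∧ ∀ x, run e x = Function.update x u
      (xor (x u) (xor (x z) (x a && x b) && (x c && x d))) := by
  simp only [List.nodup_cons, List.mem_cons, List.not_mem_nil, or_false, not_or] at h
  obtain ⟨⟨uz, ua, ub, uc, ud⟩, ⟨za, zb, zc, zd⟩, ⟨ab, ac, ad⟩, ⟨bc, bd⟩, cd, -⟩ := h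
  set A : Finset (Fin N) := {u, z, a, b, c, d} with hA
  have h₁ : Bounded A 1 1 [MCX.toffoli a b z za zb] :=
    .singleton (MCX.toffoli_isToffoliOrX _ _ ab) (by
      rw [MCX.toffoli_support, hA]; intro q; simp only [Finset.mem_insert, Finset.mem_singleton]
      tauto)
  have h₂ : Bounded A 1 1 [MCX.toffoli c d a ac ad] :=
    .singleton (MCX.toffoli_isToffoliOrX _ _ cd) (by
      rw [MCX.toffoli_support, hA]; intro q; simp only [Finset.mem_insert, Finset.mem_singleton]
      tauto)
  have h₃ : Bounded A 1 1 [MCX.toffoli z a u uz ua] :=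
    .singleton (MCX.toffoli_isToffoliOrX _ _ za) (by
      rw [MCX.toffoli_support, hA]; intro q; simp only [Finset.mem_insert, Finset.mem_singleton]
      tauto)
  -- With `z' = z ⊕ ab`, the qubit `a` acts as a dirty ancilla for `cd`: the two gates on `u` add
  -- `z' (a ⊕ cd)` and `z' a`, that is `z' cd` in total. The final gate undoes the change of `z`.
  refine ⟨_, ((((h₁.append h₂).append h₃).append h₂).append h₃).append h₁, fun x => ?_⟩
  have uz' := Ne.symm uz
  have ua' := Ne.symm ua
  have ub' := Ne.symm ub
  have uc' := Ne.symm uc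
  have ud' := Ne.symm ud
  have za' := Ne.symm za
  have zb' := Ne.symm zb
  have zc' := Ne.symm zc
  have zd' := Ne.symm zd
  have ab' := Ne.symm ab
  have ac' := Ne.symm ac
  have ad' := Ne.symm ad
  funext q
  simp only [run_append, run_cons, run_nil, MCX.toffoli_act]
  by_cases hu : q = u
  · subst hu
    simp only [Function.update_self, Function.update_of_ne, ne_eq, *, not_false_eq_true]
    cases x q <;> cases x z <;> cases x a <;> cases x b <;> cases x c <;> cases x d <;> rfl
  by_cases hz : q = z
  · subst hz
    simp only [Function.update_self, Function.update_of_ne, ne_eq, *, not_false_eq_true]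
    cases x q <;> cases x a <;> cases x b <;> cases x c <;> cases x d <;> rfl
  by_cases ha : q = a
  · subst ha
    simp only [Function.update_self, Function.update_of_ne, ne_eq, *, not_false_eq_true]
    cases x q <;> cases x c <;> cases x d <;> rfl
  simp only [Function.update_of_ne, ne_eq, *, not_false_eq_true]

/-- Conjunctions of groups of four qubits of `A` are computed into the clean qubits of `W`, with
clean workspace `Y`. -/
theorem exists_and_groups (w : ℕ) (W Y A : Finset (Fin N)) (hWY : Disjoint W Y)
    (hWA : Disjoint W A) (hYA : Disjoint Y A) (hW : W.card = w) (hY : Y.card = w)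
    (hA : A.card = 4 * w) :
    ∃ c : Circuit N, Bounded (W ∪ Y ∪ A) 6 (6 * w) c ∧ (∀ x, ∀ q ∉ W, run c x q = x q) ∧
      ∀ x, (∀ q ∈ W, x q = false) → (∀ q ∈ Y, x q = false) →
        ((∀ q ∈ W, run c x q = true) ↔ ∀ q ∈ A, x q = true) := by
  induction w generalizing W Y A with
  | zero =>
    rw [Finset.card_eq_zero.1 hW, Finset.card_eq_zero.1 hA]
    exact ⟨[], (Bounded.nil _).mono le_rfl (by simp) (by simp), by simp, by simp⟩
  | succ w ih =>
    obtain ⟨u, W, hu, rfl, hW'⟩ := Finset.card_eq_succ.1 hW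
    obtain ⟨z, Y, hz, rfl, hY'⟩ := Finset.card_eq_succ.1 hY
    obtain ⟨a, A, ha, rfl, h₁⟩ := Finset.card_eq_succ.1 (show A.card = (4 * w + 3) + 1 from hA)
    obtain ⟨b, A, hb, rfl, h₂⟩ := Finset.card_eq_succ.1 (show A.card = (4 * w + 2) + 1 from h₁)
    obtain ⟨c, A, hc, rfl, h₃⟩ := Finset.card_eq_succ.1 (show A.card = (4 * w + 1) + 1 from h₂)
    obtain ⟨d, A, hd, rfl, hA'⟩ := Finset.card_eq_succ.1 (show A.card = 4 * w + 1 from h₃)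
    simp only [Finset.disjoint_insert_left, Finset.disjoint_insert_right, Finset.mem_insert,
      not_or] at hWY hWA hYA ha hb hc
    obtain ⟨e, he, hev⟩ := exists_and_four (u := u) (z := z) (a := a) (b := b) (c := c) (d := d)
      (by simp only [List.nodup_cons, List.mem_cons, List.not_mem_nil, or_false, not_or]; grind)
    obtain ⟨f, hf, hfW, hfv⟩ := ih W Y A (by simp_all) (by simp_all) (by simp_all) hW' hY' hA'
    have hdis : Disjoint ({u, z, a, b, c, d} : Finset (Fin N)) (W ∪ Y ∪ A) := by
      simp only [Finset.disjoint_insert_left, Finset.disjoint_singleton_left, Finset.mem_union]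
      grind
    have hd' : ∀ q ∈ W ∪ Y ∪ A, q ∉ ({u, z, a, b, c, d} : Finset (Fin N)) := fun _ h =>
      Finset.disjoint_right.1 hdis h
    refine ⟨e ++ f, (he.par hdis hf).mono (fun q => ?_) le_rfl (by omega), fun x q hq => ?_,
      fun x hxW hxY => ?_⟩
    · simp only [Finset.mem_insert, Finset.mem_singleton, Finset.mem_union]
      clear * -
      tauto
    · rw [Finset.mem_insert, not_or] at hq
      rw [run_append, hfW _ _ hq.2, hev, Function.update_of_ne hq.1]
    · have key : ∀ q ∈ W ∪ Y ∪ A, run e x q = x q := fun q hq => he.run_of_notMem x (hd' q hq)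
      have hu' : run f (run e x) u = (x a && x b && (x c && x d)) := by
        rw [hfW _ _ hu, hev, Function.update_self, hxW u (by simp), hxY z (by simp)]
        simp
      have h1 := hfv (run e x) (fun q hq => by
          rw [key q (by simp [hq])]; exact hxW q (by simp [hq]))
        (fun q hq => by rw [key q (by simp [hq])]; exact hxY q (by simp [hq]))
      have h2 : (∀ q ∈ A, run e x q = true) ↔ ∀ q ∈ A, x q = true :=
        forall₂_congr fun q hq => by rw [key q (by simp [hq])]
      rw [h2] at h1
      simp only [Finset.forall_mem_insert, run_append, hu', h1, Bool.and_eq_true]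
      clear * -
      tauto

/-- Within depth `d` and with `k` gates on `Z ∪ S`, the conjunction of the qubits of `S` can be
computed into some qubit, provided that the qubits of `Z` are clean. The other qubits of `Z ∪ S`
may be changed. -/
def ComputesAnd (Z S : Finset (Fin N)) (d k : ℕ) : Prop :=
  ∃ (c : Circuit N) (r : Fin N), r ∈ Z ∪ S ∧ Bounded (Z ∪ S) d k c ∧
    ∀ x, (∀ q ∈ Z, x q = false) → (run c x r = true ↔ ∀ q ∈ S, x q = true)

theorem computesAnd_of_card_le {d : ℕ} {Z S : Finset (Fin N)} (hZS : Disjoint Z S)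
    (hS : S.Nonempty) (hd : S.card ≤ 2 ^ d) (hZ : S.card ≤ Z.card) :
    ComputesAnd Z S d S.card := by
  obtain ⟨c, r, hr, -, hc, -, h⟩ := exists_tree d S Z hZS.symm hS hd (by omega)
  rw [Finset.union_comm] at hr hc
  exact ⟨c, r, hr, hc.mono le_rfl le_rfl (Nat.sub_le _ _), h⟩

/-- Once the conjunction of `A` is computed into a qubit of the clean workspace `Z`, the qubits of
`A` are clean if that conjunction holds, so that they are workspace for the conjunction of `S`. -/
theorem ComputesAnd.merge {Z A S : Finset (Fin N)} {y r : Fin N} {c₁ c₂ : Circuit N}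
    {d₁ d₂ k₁ k₂ k₃ : ℕ} (hyZ : y ∉ Z) (hyA : y ∉ A) (hyS : y ∉ S) (hZA : Disjoint Z A)
    (hZS : Disjoint Z S) (hAS : Disjoint A S) (h₁ : Bounded (insert y Z ∪ A) d₁ k₁ c₁)
    (hy : ∀ x, run c₁ x y = x y) (hA : ∀ x, ∀ q ∈ A, run c₁ x q = x q) (h₂ : Bounded Z d₂ k₂ c₂) (hr : r ∈ Z)
    (hand : ∀ x, (∀ q ∈ insert y Z, x q = false) →
      (run c₂ (run c₁ x) r = true ↔ ∀ q ∈ A, x q = true))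
    (h₃ : ComputesAnd A S d₂ k₃) :
    ComputesAnd (insert y Z) (A ∪ S) (d₁ + d₂ + 2) (k₁ + A.card + (k₂ + k₃) + 1) := by
  obtain ⟨c₃, r', hr', h₃, hand'⟩ := h₃
  obtain ⟨f, hf, hfv⟩ := exists_flip A
  have hZAS : Disjoint Z (A ∪ S) := Finset.disjoint_union_right.2 ⟨hZA, hZS⟩
  have hyAS : y ∉ A ∪ S := by simp [hyA, hyS]
  have hyr : y ≠ r := fun e => hyZ (e ▸ hr)
  have hyr' : y ≠ r' := fun e => hyAS (e ▸ hr')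
  have hrr' : r ≠ r' := fun e => Finset.disjoint_left.1 hZAS hr (e ▸ hr')
  set B := insert y Z ∪ (A ∪ S) with hB
  have hZB' : insert y Z ⊆ B := Finset.subset_union_left
  have hZB : Z ⊆ B := (Finset.subset_insert y Z).trans hZB'
  have hASB : A ∪ S ⊆ B := Finset.subset_union_right
  have hAB : A ⊆ B := Finset.subset_union_left.trans hASB
  have hyB : y ∈ B := Finset.mem_union_left _ (Finset.mem_insert_self _ _)
  have h₄ : Bounded B 1 1 [MCX.toffoli r r' y hyr hyr'] := by
    refine .singleton (MCX.toffoli_isToffoliOrX _ _ hrr') ?_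
    rw [MCX.toffoli_support]
    intro q hq
    simp only [Finset.mem_insert, Finset.mem_singleton] at hq
    rcases hq with rfl | rfl | rfl
    exacts [hyB, hZB hr, hASB hr']
  -- `c₂` and `c₃` act on the disjoint sets `Z` and `A ∪ S`, hence run in parallel. The two extra
  -- time steps are the flip of `A` and the last Toffoli gate.
  refine ⟨c₁ ++ f ++ (c₂ ++ c₃) ++ [MCX.toffoli r r' y hyr hyr'], y, hyB,
    ((((h₁.mono (Finset.union_subset hZB' hAB) le_rfl le_rfl).append
      (hf.mono hAB le_rfl le_rfl)).append ((h₂.par hZAS h₃).mono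
        (Finset.union_subset hZB hASB) le_rfl le_rfl)).append h₄).mono le_rfl (by omega) le_rfl,
    fun x hx => ?_⟩
  have hxy : x y = false := hx y (Finset.mem_insert_self _ _)
  simp only [run_append, run_cons, run_nil, MCX.toffoli_act, Function.update_self]
  have e₁ : run c₃ (run c₂ (run f (run c₁ x))) y = false := by
    rw [h₃.run_of_notMem _ hyAS, h₂.run_of_notMem _ hyZ, hf.run_of_notMem _ hyA,
      hy, hxy]
  have e₂ : run c₃ (run c₂ (run f (run c₁ x))) r = run c₂ (run c₁ x) r := by
    rw [h₃.run_of_notMem _ (Finset.disjoint_left.1 hZAS hr)]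
    exact h₂.run_congr (fun q hq => hf.run_of_notMem _ (Finset.disjoint_left.1 hZA hq)) r hr
  rw [e₁, e₂, Bool.false_xor, Bool.and_eq_true, hand x hx]
  have e₃ : (∀ q ∈ A ∪ S, x q = true) ↔ (∀ q ∈ A, x q = true) ∧ ∀ q ∈ S, x q = true := by
    simp only [Finset.mem_union, or_imp, forall_and]
  rw [e₃]
  -- The output of `c₃` matters only when the bits of `A` are all 1, which is exactly when the
  -- flipped `A` is clean.
  refine and_congr_right fun hxA => ?_
  rw [hand']
  · refine forall₂_congr fun q hq => ?_
    rw [h₂.run_of_notMem _ (Finset.disjoint_right.1 hZS hq),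
      hf.run_of_notMem _ (Finset.disjoint_right.1 hAS hq), h₁.run_of_notMem]
    rw [Finset.mem_union, Finset.mem_insert, not_or, not_or]
    exact ⟨⟨fun e => hyS (e ▸ hq), Finset.disjoint_right.1 hZS hq⟩,
      Finset.disjoint_right.1 hAS hq⟩
  · intro q hq
    rw [h₂.run_of_notMem _ (Finset.disjoint_right.1 hZA hq), hfv _ q hq, hA _ q hq, hxA q hq]
    rfl

theorem ComputesAnd.mono {Z S : Finset (Fin N)} {d d' k k' : ℕ} (h : ComputesAnd Z S d k)
    (hd : d ≤ d') (hk : k ≤ k') : ComputesAnd Z S d' k' := by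
  obtain ⟨c, r, hr, hc, h⟩ := h
  exact ⟨c, r, hr, hc.mono le_rfl hd hk, h⟩

/-- The range between the plain tree and the doubling step: test `|Z|` qubits by a tree, then use
them as workspace for the at most `|Z|` remaining ones. -/
theorem computesAnd_of_card_le_two_mul {d : ℕ} {Z S : Finset (Fin N)} (hZS : Disjoint Z S)
    (hZ₂ : 2 ≤ Z.card) (hd : S.card ≤ 2 ^ d) (hZ : Z.card < S.card) (hS : S.card ≤ 2 * Z.card) :
    ComputesAnd Z S (2 * d + 2) (3 * S.card) := by
  obtain ⟨A, hAS, hA⟩ := Finset.exists_subset_card_eq (s := S) (n := Z.card) hZ.le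
  obtain ⟨y, hy⟩ : Z.Nonempty := Finset.card_pos.1 (by omega)
  have hZe : (Z.erase y).card = Z.card - 1 := Finset.card_erase_of_mem hy
  have hSA : (S \ A).card = S.card - Z.card := by rw [Finset.card_sdiff_of_subset hAS, hA]
  have hyS : y ∉ S := Finset.disjoint_left.1 hZS hy
  have hZS' : Disjoint (Z.erase y) S := hZS.mono_left (Finset.erase_subset _ _)
  obtain ⟨c, r, -, hr, hc, hcA, hand⟩ := exists_tree d A (Z.erase y) (hZS'.mono_right hAS).symm
    (Finset.card_pos.1 (by omega)) (by omega) (by omega)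
  -- The tree already leaves `A` unchanged, so it is taken as `c₁` and nothing remains for `c₂`.
  have h := ComputesAnd.merge (c₂ := []) (d₂ := d) (k₂ := 0) (S := S \ A)
    (Finset.notMem_erase y Z) (fun h => hyS (hAS h))
    (fun h => hyS (Finset.sdiff_subset h)) (hZS'.mono_right hAS)
    (hZS'.mono_right Finset.sdiff_subset) Finset.disjoint_sdiff
    (hc.mono (by
      rw [Finset.union_comm]
      exact Finset.union_subset_union_left (Finset.subset_insert _ _)) le_rfl le_rfl)
    (fun x => hcA x y (Finset.notMem_erase y Z))
    (fun x q hq => hcA x q (Finset.disjoint_right.1 (hZS'.mono_right hAS) hq))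
    ((Bounded.nil _).mono le_rfl (Nat.zero_le _) le_rfl) (hr (by omega))
    (fun x hx => hand x fun q hq => hx q (Finset.mem_insert_of_mem hq))
    (computesAnd_of_card_le Finset.disjoint_sdiff (Finset.card_pos.1 (by omega)) (by omega)
      (by omega))
  rw [Finset.insert_erase hy, Finset.union_sdiff_of_subset hAS] at h
  exact h.mono (by omega) (by omega)

/-- Conjunctions in logarithmic depth and with linearly many gates, with few clean qubits. -/
theorem computesAnd {d : ℕ} (j w : ℕ) (Z S : Finset (Fin N)) (hZS : Disjoint Z S) (hw : 0 < w)
    (hZ : Z.card = 2 * w) (hS : S.Nonempty) (hd : S.card ≤ 2 ^ d) (hj : S.card ≤ 2 * w * 2 ^ j) :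
    ComputesAnd Z S (2 * d + 2 + 8 * j) (3 * S.card) := by
  induction j generalizing w Z S with
  | zero => exact (computesAnd_of_card_le hZS hS hd (by omega)).mono (by omega) (by omega)
  | succ j ih =>
    by_cases hle : S.card ≤ Z.card
    · exact (computesAnd_of_card_le hZS hS hd hle).mono (by omega) (by omega)
    by_cases hle₂ : S.card ≤ 2 * Z.card
    · exact (computesAnd_of_card_le_two_mul hZS (by omega) hd (by omega) hle₂).mono
        (by omega) le_rfl
    -- A group of four uses one output qubit in `W` and one auxiliary qubit in `Y`, so the `2w`
    -- clean qubits handle `4w` controls. These become a workspace of size `2 * (2 * w)` for the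
    -- recursive call.
    obtain ⟨A, hAS, hA⟩ := Finset.exists_subset_card_eq (s := S) (n := 4 * w) (by omega)
    obtain ⟨W, hWZ, hW⟩ := Finset.exists_subset_card_eq (s := Z) (n := w) (by omega)
    have hSA : (S \ A).card = S.card - 4 * w := by rw [Finset.card_sdiff_of_subset hAS, hA]
    have hY : (Z \ W).card = w := by rw [Finset.card_sdiff_of_subset hWZ, hW]; omega
    have hYZ : Z \ W ⊆ Z := Finset.sdiff_subset
    have hWY : Disjoint W (Z \ W) := Finset.disjoint_sdiff
    have hWYZ : W ∪ Z \ W = Z := Finset.union_sdiff_of_subset hWZ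
    set Y := Z \ W
    clear_value Y
    obtain ⟨y, hy⟩ : Y.Nonempty := Finset.card_pos.1 (by omega)
    have hYe : (Y.erase y).card = w - 1 := by rw [Finset.card_erase_of_mem hy, hY]
    have hyW : y ∉ W := Finset.disjoint_right.1 hWY hy
    have hyZ : y ∈ Z := hYZ hy
    have hyS : y ∉ S := Finset.disjoint_left.1 hZS hyZ
    have hZe : W ∪ Y.erase y = Z.erase y := by
      rw [← hWYZ, Finset.erase_union_distrib, Finset.erase_eq_of_notMem hyW]
    have hZS' : Disjoint (Z.erase y) S := hZS.mono_left (Finset.erase_subset _ _)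
    have hZA : Disjoint Z A := hZS.mono_right hAS
    obtain ⟨c₁, h₁, hfix, hv₁⟩ := exists_and_groups w W Y A hWY (hZA.mono_left hWZ)
      (hZA.mono_left hYZ) hW hY hA
    obtain ⟨c₂, r, hr, -, h₂, -, hv₂⟩ := exists_tree d W (Y.erase y)
      (hWY.mono_right (Finset.erase_subset _ _)) (Finset.card_pos.1 (by omega)) (by omega)
      (by omega)
    rw [hWYZ] at h₁
    rw [hZe] at hr h₂
    have h₃ := ih (2 * w) A (S \ A) Finset.disjoint_sdiff (by omega) (by omega)
      (Finset.card_pos.1 (by omega)) (by omega) (by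
        rw [pow_succ] at hj
        have : w ≤ w * 2 ^ j := Nat.le_mul_of_pos_right _ (by positivity)
        have e₁ : 2 * w * (2 ^ j * 2) = 4 * (w * 2 ^ j) := by ring
        have e₂ : 2 * (2 * w) * 2 ^ j = 4 * (w * 2 ^ j) := by ring
        omega)
    have h := ComputesAnd.merge (S := S \ A) (d₁ := 6) (Finset.notMem_erase y Z)
      (fun h => hyS (hAS h)) (fun h => hyS (Finset.sdiff_subset h)) (hZS'.mono_right hAS)
      (hZS'.mono_right Finset.sdiff_subset) Finset.disjoint_sdiff
      (by rwa [Finset.insert_erase hyZ]) (fun x => hfix x y hyW)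
      (fun x q hq => hfix x q fun hqW => Finset.disjoint_left.1 hZA (hWZ hqW) hq)
      (h₂.mono le_rfl (show d ≤ 2 * d + 2 + 8 * j by omega) le_rfl) hr (fun x hx => ?_) h₃
    · rw [Finset.insert_erase hyZ, Finset.union_sdiff_of_subset hAS] at h
      -- The depth grows by `6 + 2`. The gates number `6w` for groups, `4w` flips, `w - 1` for the
      -- tree, one merge and `3 (|S| - 4w)` for the recursion, at most `3 |S|` altogether.
      exact h.mono (by omega) (by omega)
    · rw [Finset.insert_erase hyZ] at hx
      rw [hv₂ _ fun q hq => ?_]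
      · exact hv₁ x (fun q hq => hx q (hWZ hq)) fun q hq => hx q (hYZ hq)
      · have hqY := Finset.mem_of_mem_erase hq
        rw [hfix _ _ (Finset.disjoint_right.1 hWY hqY)]
        exact hx q (hYZ hqY)

/-! ### Multi-controlled gates with one dirty ancilla -/

/-- A multi-controlled `X` gate with at least three controls, in logarithmic depth and with linearly
many Toffoli and `X` gates, and one dirty ancilla qubit `a`. -/
theorem exists_block {d : ℕ} (g : MCX N) {a : Fin N} (ha : a ∉ g.support)
    (hg : 3 ≤ g.controls.card) (hd : g.controls.card ≤ 2 ^ d) :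
    ∃ c : Circuit N, Bounded (insert a g.support) (40 * d + 20) (12 * g.support.card) c ∧
      c.run = g.act := by
  obtain ⟨Z, hZ, hZc⟩ := Finset.exists_subset_card_eq (s := g.controls) (n := 2) (by omega)
  set S := g.controls \ Z with hS
  have hZS : Disjoint Z S := Finset.disjoint_sdiff
  have hSc : S.card = g.controls.card - 2 := by rw [Finset.card_sdiff_of_subset hZ, hZc]
  have hU : Z ∪ S = g.controls := Finset.union_sdiff_of_subset hZ
  -- Two of the controls, once flipped, play the role of the clean workspace of size `2 * 1`.
  obtain ⟨v, r, hr, hv, hand⟩ := computesAnd (d := d) d 1 Z S hZS one_pos hZc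
    (Finset.card_pos.1 (by omega)) (by omega) (by omega)
  obtain ⟨f, hf, hfv⟩ := exists_flip Z
  obtain ⟨p, q, hpq, rfl⟩ := Finset.card_eq_two.1 hZc
  rw [hU] at hr hv
  have hsc : g.support.card = g.controls.card + 1 := Finset.card_insert_of_notMem g.target_notMem
  have hV := (hf.mono hZ le_rfl le_rfl).append hv
  rw [hZc] at hV
  set V := f ++ v with hVdef
  have hat : a ≠ g.target := fun e => ha (e ▸ g.target_mem_support)
  have hac : a ∉ g.controls := fun h => ha (Finset.mem_insert_of_mem h)
  have hp : p ∈ g.controls := hZ (by simp)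
  have hq : q ∈ g.controls := hZ (by simp)
  have hap : a ≠ p := fun e => hac (e ▸ hp)
  have haq : a ≠ q := fun e => hac (e ▸ hq)
  have htr : g.target ≠ r := fun e => g.target_notMem (e ▸ hr)
  have har : a ≠ r := fun e => hac (e ▸ hr)
  set B := insert a g.support with hB
  have hcB : g.controls ⊆ B := (Finset.subset_insert _ _).trans (Finset.subset_insert _ _)
  have haB : a ∈ B := Finset.mem_insert_self _ _
  have htB : g.target ∈ B := Finset.mem_insert_of_mem g.target_mem_support
  have h₁ : Bounded B 1 1 [MCX.toffoli a r g.target hat.symm htr] := by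
    refine .singleton (MCX.toffoli_isToffoliOrX _ _ har) ?_
    rw [MCX.toffoli_support, Finset.insert_subset_iff, Finset.insert_subset_iff,
      Finset.singleton_subset_iff]
    exact ⟨htB, haB, hcB hr⟩
  have h₂ : Bounded B 1 1 [MCX.toffoli p q a hap haq] := by
    refine .singleton (MCX.toffoli_isToffoliOrX _ _ hpq) ?_
    rw [MCX.toffoli_support, Finset.insert_subset_iff, Finset.insert_subset_iff,
      Finset.singleton_subset_iff]
    exact ⟨haB, hcB hp, hcB hq⟩
  have hVB := hV.mono hcB le_rfl le_rfl
  have h₃ := (hVB.append h₁).append hVB.reverse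
  -- `V` moves only controls, so conjugation by it restores them for every input, whether or not `Z`
  -- becomes clean.
  have conj : ∀ x, run (V ++ [MCX.toffoli a r g.target hat.symm htr] ++ V.reverse) x =
      Function.update x g.target (xor (x g.target) (x a && run V x r)) := by
    intro x
    have key : ∀ s ∈ g.controls, run (V ++ [MCX.toffoli a r g.target hat.symm htr]) x s =
        run V x s := by
      intro s hs
      rw [run_append, run_cons, run_nil, MCX.toffoli_act, Function.update_of_ne]
      exact fun e => g.target_notMem (e ▸ hs)
    funext s
    rw [run_append]
    by_cases hs : s ∈ g.controls
    · rw [hV.reverse.run_congr key s hs, run_reverse_run, Function.update_of_ne]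
      exact fun e => g.target_notMem (e ▸ hs)
    · rw [hV.reverse.run_of_notMem _ hs, run_append, run_cons, run_nil, MCX.toffoli_act,
        hV.run_of_notMem _ g.target_notMem, hV.run_of_notMem _ hac]
      by_cases e : s = g.target
      · subst e; simp
      · rw [Function.update_of_ne e, Function.update_of_ne e, hV.run_of_notMem _ hs]
  have hroot : ∀ x, x p = true → x q = true →
      (run V x r = true ↔ ∀ s ∈ S, x s = true) := by
    intro x hxp hxq
    rw [hVdef, run_append, hand]
    · refine forall₂_congr fun s hs => ?_
      rw [hf.run_of_notMem _ (Finset.disjoint_right.1 hZS hs)]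
    · intro s hs
      rw [hfv _ s hs]
      simp only [Finset.mem_insert, Finset.mem_singleton] at hs
      rcases hs with rfl | rfl <;> simp [*]
  have hVr : ∀ x b, run V (Function.update x a b) r = run V x r := fun x b =>
    hV.run_congr (fun s hs => Function.update_of_ne (ne_of_mem_of_not_mem hs hac) _ _) r hr
  have hVt : ∀ x b, run V (Function.update x g.target b) r = run V x r := fun x b =>
    hV.run_congr
      (fun s hs => Function.update_of_ne (ne_of_mem_of_not_mem hs g.target_notMem) _ _) r hr
  have hpt : p ≠ g.target := fun e => g.target_notMem (e ▸ hp)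
  have hqt : q ≠ g.target := fun e => g.target_notMem (e ▸ hq)
  have hall : ∀ x, decide (∀ i ∈ g.controls, x i = true) = (x p && x q && run V x r) := by
    intro x
    rw [Bool.eq_iff_iff, decide_eq_true_eq, ← hU]
    simp only [Finset.mem_union, Finset.mem_insert, Finset.mem_singleton, or_imp, forall_and,
      forall_eq, Bool.and_eq_true]
    exact and_congr_right fun h => (hroot x h.1 h.2).symm
  generalize V ++ [MCX.toffoli a r g.target hat.symm htr] ++ V.reverse = M at conj h₃
  -- With `R = run V x r`, the target receives `a R ⊕ (a ⊕ pq) R = pq R`, and the second gate on `a`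
  -- restores it. The value of `R` is meaningful precisely when `p` and `q` are both 1; otherwise it
  -- is multiplied by 0.
  refine ⟨_, (((h₃.append h₂).append h₃).append h₂).mono le_rfl (by omega) (by omega), ?_⟩
  funext x
  rw [run_append, run_append, run_append, conj, conj, MCX.act, hall]
  simp only [run_cons, run_nil, MCX.toffoli_act, hVr, hVt]
  funext s
  by_cases hst : s = g.target
  · subst hst
    simp only [Function.update_self, Function.update_of_ne, ne_eq, hat, hat.symm, hap.symm,
      haq.symm, hpt, hqt, not_false_eq_true]
    cases x g.target <;> cases x a <;> cases x p <;> cases x q <;> cases run V x r <;> rfl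
  by_cases hsa : s = a
  · subst hsa
    simp only [Function.update_self, Function.update_of_ne, ne_eq, hat, hat.symm, hap.symm,
      haq.symm, hpt, hqt, not_false_eq_true]
    cases x s <;> cases x p <;> cases x q <;> rfl
  simp only [Function.update_of_ne, ne_eq, hst, hsa, not_false_eq_true]

/-! ### Layers of parallel gates -/

theorem run_of_forall_target_ne {c : Circuit N} {q : Fin N} (h : ∀ g ∈ c, g.target ≠ q)
    (x : BasisState N) : run c x q = x q := by
  induction c generalizing x with
  | nil => rfl
  | cons g c ih =>
    rw [run_cons, ih fun u hu => h u (List.mem_cons_of_mem _ hu)]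
    exact g.act_of_ne x (h g List.mem_cons_self).symm

/-- Earlier gates of the layer leave the support of `g` alone, and later ones leave its target
alone. -/
theorem IsLayer.run_target {l : Circuit N} (hl : IsLayer l) (x : BasisState N) {g : MCX N}
    (hg : g ∈ l) : run l x g.target = g.act x g.target := by
  induction l generalizing x with
  | nil => cases hg
  | cons h l ih =>
    obtain ⟨hh, hl⟩ := List.pairwise_cons.1 hl
    rw [run_cons]
    rcases List.mem_cons.1 hg with rfl | hg
    · refine run_of_forall_target_ne (fun u hu e => ?_) _
      exact Finset.disjoint_left.1 (hh u hu) g.target_mem_support (e ▸ u.target_mem_support)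
    · rw [ih hl _ hg]
      refine g.act_congr (fun q hq => h.act_of_ne x ?_) _ g.target_mem_support
      rintro rfl
      exact Finset.disjoint_left.1 (hh g hg) h.target_mem_support hq

theorem run_flatMap {l : Circuit N} {block : MCX N → Circuit N}
    (h : ∀ g ∈ l, (block g).run = g.act) : run (l.flatMap block) = run l := by
  induction l with
  | nil => rfl
  | cons g l ih =>
    funext x
    rw [List.flatMap_cons, run_append, run_cons, h g List.mem_cons_self,
      ih fun u hu => h u (List.mem_cons_of_mem _ hu)]

theorem Bounded.flatMap {l : Circuit N} {block : MCX N → Circuit N} {A : MCX N → Finset (Fin N)}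
    {d : ℕ} {k : MCX N → ℕ} (hA : l.Pairwise fun g h => Disjoint (A g) (A h))
    (h : ∀ g ∈ l, Bounded (A g) d (k g) (block g)) :
    Bounded Finset.univ d (l.map k).sum (l.flatMap block) := by
  -- The induction must remember that only qubits of the sets `A g` are used, to get disjointness
  -- from the next block.
  suffices ∃ B : Finset (Fin N), (∀ q ∈ B, ∃ g ∈ l, q ∈ A g) ∧
      Bounded B d (l.map k).sum (l.flatMap block) by
    obtain ⟨B, -, hB⟩ := this
    exact hB.mono (Finset.subset_univ B) le_rfl le_rfl
  induction l with
  | nil => exact ⟨∅, by simp, (Bounded.nil _).mono le_rfl (Nat.zero_le _) le_rfl⟩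
  | cons g l ih =>
    obtain ⟨hg, hl⟩ := List.pairwise_cons.1 hA
    obtain ⟨B, hB, hb⟩ := ih hl fun u hu => h u (List.mem_cons_of_mem _ hu)
    refine ⟨A g ∪ B, fun q hq => ?_, ?_⟩
    · rcases Finset.mem_union.1 hq with hq | hq
      · exact ⟨g, List.mem_cons_self, hq⟩
      · obtain ⟨u, hu, hq⟩ := hB q hq
        exact ⟨u, List.mem_cons_of_mem _ hu, hq⟩
    · rw [List.flatMap_cons, List.map_cons, List.sum_cons]
      refine (h g List.mem_cons_self).par (Finset.disjoint_left.2 fun q hq hqB => ?_) hb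
      obtain ⟨u, hu, hq'⟩ := hB q hqB
      exact Finset.disjoint_left.1 (hg u hu) hq hq'

/-- This turns block sizes linear in the support into a gate count linear in `N` for a whole layer.
-/
theorem IsLayer.sum_card_support_le {l : Circuit N} (hl : IsLayer l) :
    (l.map fun g => g.support.card).sum ≤ N := by
  suffices ∃ B : Finset (Fin N), (∀ q ∈ B, ∃ g ∈ l, q ∈ g.support) ∧
      B.card = (l.map fun g => g.support.card).sum by
    obtain ⟨B, -, hB⟩ := this
    rw [← hB]
    exact (Finset.card_le_univ B).trans_eq (Fintype.card_fin N)
  induction l with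
  | nil => exact ⟨∅, by simp, rfl⟩
  | cons g l ih =>
    obtain ⟨hg, hl⟩ := List.pairwise_cons.1 hl
    obtain ⟨B, hB, hb⟩ := ih hl
    refine ⟨g.support ∪ B, fun q hq => ?_, ?_⟩
    · rcases Finset.mem_union.1 hq with hq | hq
      · exact ⟨g, List.mem_cons_self, hq⟩
      · obtain ⟨u, hu, hq⟩ := hB q hq
        exact ⟨u, List.mem_cons_of_mem _ hu, hq⟩
    · rw [Finset.card_union_of_disjoint (Finset.disjoint_left.2 fun q hq hqB => ?_), hb]
      · rfl
      · obtain ⟨u, hu, hq'⟩ := hB q hqB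
        exact Finset.disjoint_left.1 (hg u hu) hq hq'

theorem Bounded.flatten {A : Finset (Fin N)} {d k : ℕ} {R : List (Circuit N)}
    (h : ∀ c ∈ R, Bounded A d k c) : Bounded A (R.length * d) (R.length * k) R.flatten := by
  induction R with
  | nil => exact (Bounded.nil A).mono le_rfl (Nat.zero_le _) (Nat.zero_le _)
  | cons c R ih =>
    rw [List.flatten_cons, List.length_cons, Nat.succ_mul, Nat.succ_mul, add_comm _ d,
      add_comm _ k]
    exact (h c List.mem_cons_self).append (ih fun u hu => h u (List.mem_cons_of_mem _ hu))

end Circuit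

/-! ### The ladder in logarithmically many layers -/

variable {N : ℕ}

/-- The gate with target `t` whose controls are the qubit `t - 2s` and the odd qubits between
`t - 2s` and `t`. -/
def rung (s : ℕ) (t : Fin N) : MCX N where
  controls := Finset.univ.filter fun q =>
    q.val < t.val ∧ (q.val + 2 * s = t.val ∨ t.val < q.val + 2 * s ∧ q.val % 2 = 1)
  target := t
  target_notMem := by simp

theorem mem_controls_rung {s : ℕ} {t q : Fin N} : q ∈ (rung s t).controls ↔
    q.val < t.val ∧ (q.val + 2 * s = t.val ∨ t.val < q.val + 2 * s ∧ q.val % 2 = 1) := by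
  simp [rung]

theorem mem_support_rung {s : ℕ} {t q : Fin N} : q ∈ (rung s t).support ↔
    q = t ∨ q ∈ (rung s t).controls := by
  simp [MCX.support, rung]

theorem le_of_mem_support_rung {s : ℕ} {t q : Fin N} (h : q ∈ (rung s t).support) :
    q.val ≤ t.val ∧ t.val ≤ q.val + 2 * s := by
  rw [mem_support_rung, mem_controls_rung] at h
  rcases h with rfl | h <;> omega

/-- The parallel rungs whose targets are the positive qubits congruent to `r` modulo `4s`. -/
def rungLayer (N s r : ℕ) : Circuit N :=
  ((List.finRange N).filter fun t => t.val % (4 * s) = r ∧ 0 < t.val).map (rung s)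

theorem mem_rungLayer {s r : ℕ} {g : MCX N} : g ∈ rungLayer N s r ↔
    ∃ t : Fin N, (t.val % (4 * s) = r ∧ 0 < t.val) ∧ rung s t = g := by
  simp [rungLayer]

theorem add_le_of_mod_eq {m t t' : ℕ} (h : t < t') (hm : t % m = t' % m) : t + m ≤ t' := by
  have := Nat.le_of_dvd (by omega) ((Nat.modEq_iff_dvd' h.le).1 hm)
  omega

/-- Each support lies in an interval of length `2 * s` ending at the target, and distinct targets
differ by at least `4 * s`. -/
theorem rungLayer_isLayer (s r : ℕ) : (rungLayer N s r).IsLayer := by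
  rw [rungLayer, Circuit.IsLayer, List.pairwise_map]
  refine ((List.pairwise_lt_finRange N).filter _).imp_of_mem fun {t t'} ht ht' hlt => ?_
  simp only [List.mem_filter, List.mem_finRange, true_and, decide_eq_true_eq] at ht ht'
  rw [Fin.lt_def] at hlt
  have h := add_le_of_mod_eq hlt (ht.1.trans ht'.1.symm)
  refine Finset.disjoint_left.2 fun q hq hq' => ?_
  have := le_of_mem_support_rung hq
  have := le_of_mem_support_rung hq'
  omega

theorem run_rungLayer {s r : ℕ} (x : BasisState N) (q : Fin N) :
    (rungLayer N s r).run x q =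
      if q.val % (4 * s) = r ∧ 0 < q.val then (rung s q).act x q else x q := by
  split_ifs with h
  · exact (rungLayer_isLayer s r).run_target x (mem_rungLayer.2 ⟨q, h, rfl⟩)
  · refine Circuit.run_of_forall_target_ne (fun g hg => ?_) x
    obtain ⟨t, ht, rfl⟩ := mem_rungLayer.1 hg
    rintro rfl
    exact h ht

/-- The ladder in which the rungs have length `s`. -/
def strideLadder (s : ℕ) (x : BasisState N) : BasisState N := fun q =>
  if q.val % (2 * s) = 0 ∧ 0 < q.val then (rung s q).act x q else x q

theorem rung_act_self (s : ℕ) (x : BasisState N) (q : Fin N) :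
    (rung s q).act x q = xor (x q) (decide (∀ i ∈ (rung s q).controls, x i = true)) :=
  (rung s q).act_target x

theorem forall_controls_rung {s : ℕ} (hs : 0 < s) {p q : Fin N} (hpq : p.val + 2 * s = q.val)
    (x : BasisState N) : (∀ i ∈ (rung s q).controls, x i = true) ↔ x p = true ∧
      ∀ i : Fin N, p.val < i.val → i.val < q.val → i.val % 2 = 1 → x i = true := by
  simp only [mem_controls_rung]
  constructor
  · exact fun h => ⟨h p (by omega), fun i h₁ h₂ h₃ => h i (by omega)⟩
  · rintro ⟨h, h'⟩ i ⟨h₁, h₂ | h₂⟩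
    · have : i = p := Fin.ext (by omega)
      rwa [this]
    · exact h' i (by omega) h₁ h₂.2

theorem mod_two_mul_eq_zero_iff {s : ℕ} (hs : 0 < s) (q : ℕ) :
    q % (2 * s) = 0 ↔ q % (4 * s) = 0 ∨ q % (4 * s) = 2 * s := by
  have h : q % (4 * s) = q % (2 * s) + 2 * s * (q / (2 * s) % 2) := by
    rw [← Nat.mod_mul]
    congr 1
    ring
  have hlt : q % (2 * s) < 2 * s := Nat.mod_lt _ (by omega)
  rcases Nat.mod_two_eq_zero_or_one (q / (2 * s)) with e | e <;> rw [e] at h <;> omega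

theorem mod_four_mul_mod_two (s q : ℕ) : q % (4 * s) % 2 = q % 2 :=
  Nat.mod_mod_of_dvd q (by omega)

/-- The recursion of the ladder in logarithmically many layers. -/
theorem rungLayer_strideLadder {s : ℕ} (hs : 0 < s) (x : BasisState N) :
    (rungLayer N s 0).run (strideLadder (2 * s) ((rungLayer N s (2 * s)).run x)) =
      strideLadder s x := by
  set y := (rungLayer N s (2 * s)).run x with hy
  set z := strideLadder (2 * s) y with hz
  have hy₁ : ∀ q : Fin N, q.val % (4 * s) ≠ 2 * s → y q = x q := fun q hq => by
    rw [hy, run_rungLayer, if_neg fun h => hq h.1]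
  have hy₂ : ∀ q : Fin N, q.val % (4 * s) = 2 * s → y q = (rung s q).act x q := fun q hq => by
    have h0 : 0 < q.val := Nat.pos_of_ne_zero fun e => by
      rw [e, Nat.zero_mod] at hq
      omega
    rw [hy, run_rungLayer, if_pos ⟨hq, h0⟩]
  have e4 : 2 * (2 * s) = 4 * s := by ring
  have hz₁ : ∀ q : Fin N, ¬(q.val % (4 * s) = 0 ∧ 0 < q.val) → z q = y q := fun q hq => by
    rw [hz, strideLadder, e4, if_neg hq]
  have hz₂ : ∀ q : Fin N, q.val % (4 * s) = 0 → 0 < q.val → z q = (rung (2 * s) q).act y q :=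
    fun q hq hq' => by rw [hz, strideLadder, e4, if_pos ⟨hq, hq'⟩]
  have hodd : ∀ q : Fin N, q.val % 2 = 1 → z q = x q := fun q hq => by
    have := mod_four_mul_mod_two s q.val
    rw [hz₁ q (by omega), hy₁ q (by omega)]
  funext q
  rw [run_rungLayer, strideLadder]
  simp only [mod_two_mul_eq_zero_iff hs]
  by_cases hq0 : 0 < q.val
  swap
  · rw [if_neg fun h => hq0 h.2, if_neg fun h => hq0 h.2, hz₁ q fun h => hq0 h.2, hy₁]
    rw [Nat.eq_zero_of_not_pos hq0, Nat.zero_mod]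
    omega
  by_cases hq2 : q.val % (4 * s) = 2 * s
  · rw [if_neg (by omega), if_pos ⟨.inr hq2, hq0⟩, hz₁ q (by omega), hy₂ q hq2]
  by_cases hq : q.val % (4 * s) = 0
  swap
  · rw [if_neg (by omega), if_neg (by omega), hz₁ q (by omega), hy₁ q hq2]
  rw [if_pos ⟨hq, hq0⟩, if_pos ⟨.inl hq, hq0⟩]
  have hle : 4 * s ≤ q.val := Nat.le_of_dvd hq0 (Nat.dvd_of_mod_eq_zero hq)
  obtain ⟨p, hp⟩ : ∃ p : Fin N, p.val + 2 * s = q.val := 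
    ⟨⟨q.val - 2 * s, by omega⟩, by dsimp only; omega⟩
  obtain ⟨r, hr⟩ : ∃ r : Fin N, r.val + 2 * s = p.val := 
    ⟨⟨p.val - 2 * s, by omega⟩, by dsimp only; omega⟩
  have hr4 : r.val % (4 * s) = 0 := by
    rw [← hq, ← hp, ← hr, show r.val + 2 * s + 2 * s = r.val + 4 * s by ring, Nat.add_mod_right]
  have hp4 : p.val % (4 * s) = 2 * s := by
    rw [← hr, Nat.add_mod, hr4, zero_add, Nat.mod_mod, Nat.mod_eq_of_lt (by omega)]
  have hp2 : p.val % 2 = 0 := by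
    have := mod_four_mul_mod_two s p.val
    omega
  have hyodd : ∀ i : Fin N, i.val % 2 = 1 → y i = x i := fun i hi => by
    have := mod_four_mul_mod_two s i.val
    exact hy₁ i (by omega)
  rw [rung_act_self, rung_act_self, hz₂ q hq hq0, rung_act_self, hy₁ q hq2]
  have key₁ : (∀ i ∈ (rung s q).controls, z i = true) ↔ y p = true ∧
      ∀ i : Fin N, p.val < i.val → i.val < q.val → i.val % 2 = 1 → x i = true := by
    rw [forall_controls_rung hs hp, hz₁ p (by omega)]
    refine and_congr_right fun _ => forall_congr' fun i => ?_
    refine forall₂_congr fun _ _ => forall_congr' fun hi => ?_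
    rw [hodd i hi]
  have key₂ : (∀ i ∈ (rung (2 * s) q).controls, y i = true) ↔
      (∀ i ∈ (rung s p).controls, x i = true) ∧
      ∀ i : Fin N, p.val < i.val → i.val < q.val → i.val % 2 = 1 → x i = true := by
    rw [forall_controls_rung (by omega) (show r.val + 2 * (2 * s) = q.val by omega),
      forall_controls_rung hs hr, hy₁ r (by omega), and_assoc]
    refine and_congr_right fun _ => ⟨fun h => ⟨fun i h₁ h₂ h₃ => ?_, fun i h₁ h₂ h₃ => ?_⟩,
      fun h i h₁ h₂ h₃ => ?_⟩
    · rw [← hyodd i h₃]; exact h i h₁ (by omega) h₃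
    · rw [← hyodd i h₃]; exact h i (by omega) h₂ h₃
    · rw [hyodd i h₃]
      rcases lt_trichotomy i.val p.val with hi | hi | hi
      · exact h.1 i h₁ hi h₃
      · omega
      · exact h.2 i hi h₂ h₃
  -- All quantities are now Boolean: `a` and `b` below are `x_r O(r, p)` and `O(p, q)`, and the
  -- claim is `(x_q ⊕ a b) ⊕ (x_p ⊕ a) b = x_q ⊕ x_p b`.
  simp only [key₁, key₂, forall_controls_rung hs hp, Bool.decide_and, hy₂ p hp4, rung_act_self,
    Bool.decide_eq_true]
  generalize decide (∀ i ∈ (rung s p).controls, x i = true) = a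
  generalize decide (∀ i : Fin N, p.val < i.val → i.val < q.val → i.val % 2 = 1 → x i = true) = b
  cases x q <;> cases x p <;> cases a <;> cases b <;> rfl

theorem strideLadder_of_le {s : ℕ} (h : N ≤ 2 * s) (x : BasisState N) :
    strideLadder s x = x := by
  funext q
  rw [strideLadder, Nat.mod_eq_of_lt (by omega), if_neg (by omega)]

/-- Layers of rungs of lengths `s, 2s, …, 2^(k-1) s`, and back. -/
def ladderLayers (N : ℕ) : ℕ → ℕ → List (Circuit N)
  | 0, _ => []
  | k + 1, s => rungLayer N s (2 * s) :: (ladderLayers N k (2 * s) ++ [rungLayer N s 0])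

theorem length_ladderLayers (k s : ℕ) : (ladderLayers N k s).length = 2 * k := by
  induction k generalizing s with
  | zero => rfl
  | succ k ih => simp [ladderLayers, ih]; ring

theorem run_ladderLayers {k s : ℕ} (hs : 0 < s) (h : N ≤ 2 ^ k * (2 * s)) (x : BasisState N) :
    Circuit.run (ladderLayers N k s).flatten x = strideLadder s x := by
  induction k generalizing s x with
  | zero => exact (strideLadder_of_le (by omega) x).symm
  | succ k ih =>
    rw [ladderLayers, List.flatten_cons, List.flatten_append, Circuit.run_append,
      Circuit.run_append, ih (by omega) (by rw [pow_succ] at h; linarith), List.flatten_singleton,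
      rungLayer_strideLadder hs]

theorem mem_ladderLayers {k s : ℕ} (hs : 0 < s) {l : Circuit N} (hl : l ∈ ladderLayers N k s) :
    ∃ s' r, 0 < s' ∧ (r = 0 ∨ r = 2 * s') ∧ l = rungLayer N s' r := by
  induction k generalizing s with
  | zero => simp [ladderLayers] at hl
  | succ k ih =>
    simp only [ladderLayers, List.mem_cons, List.mem_append, List.not_mem_nil, or_false] at hl
    rcases hl with rfl | hl | rfl
    · exact ⟨s, _, hs, .inr rfl, rfl⟩
    · exact ih (by omega) hl
    · exact ⟨s, _, hs, .inl rfl, rfl⟩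

theorem strideLadder_one (n : ℕ) : strideLadder (N := 2 * n + 1) 1 = ladderTwoAct n := by
  funext x q
  rw [strideLadder, ladderTwoAct]
  simp only [Nat.even_iff, mul_one]
  by_cases h : q.val % 2 = 0 ∧ 0 < q.val
  · rw [if_pos h, if_pos h, rung_act_self]
    congr 1
    rw [Bool.eq_iff_iff, decide_eq_true_eq, Bool.and_eq_true,
      forall_controls_rung one_pos (p := ⟨q.val - 2, by omega⟩) (by dsimp only; omega)]
    refine and_congr_right fun _ => ⟨fun h' => h' _ ?_ ?_ ?_, fun h' i h₁ h₂ h₃ => ?_⟩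
    · dsimp only; omega
    · dsimp only; omega
    · dsimp only; omega
    · have : i = ⟨q.val - 1, by omega⟩ := Fin.ext (by dsimp only at h₁ ⊢; omega)
      rwa [this]
  · rw [if_neg h, if_neg h]

/-! ### Choice of dirty ancillae and realisation of the layers -/

open Circuit

/-- The qubit two before the target, unless the gate acts on it. -/
def dirtyAncilla (g : MCX N) : Finset (Fin N) :=
  Finset.univ.filter fun q => q.val + 2 = g.target.val ∧ q ∉ g.support

theorem mem_dirtyAncilla {g : MCX N} {q : Fin N} :
    q ∈ dirtyAncilla g ↔ q.val + 2 = g.target.val ∧ q ∉ g.support := by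
  simp [dirtyAncilla]

/-- For `s ≥ 2` the qubit `t - 2` is even and strictly inside the rung, hence not a control. For `s
= 1` it is a control, but the gate is a Toffoli gate and needs no ancilla. -/
theorem exists_rung_block {d s : ℕ} {t : Fin N} (hN : N ≤ 2 ^ d) (hs : 0 < s)
    (ht : 2 * s ≤ t.val) (hev : t.val % 2 = 0) :
    ∃ c : Circuit N, Bounded ((rung s t).support ∪ dirtyAncilla (rung s t)) (40 * d + 20)
      (12 * (rung s t).support.card) c ∧ c.run = (rung s t).act := by
  have hcard : 1 ≤ (rung s t).support.card := Finset.card_pos.2 ⟨_, (rung s t).target_mem_support⟩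
  rcases Nat.lt_or_ge 1 s with h1 | h1
  · have ha : (⟨t.val - 2, by omega⟩ : Fin N) ∉ (rung s t).support := by
      rw [mem_support_rung, mem_controls_rung, Fin.ext_iff]
      dsimp only
      omega
    have h3 : 3 ≤ (rung s t).controls.card := by
      have hsub : ({⟨t.val - 2 * s, by omega⟩, ⟨t.val - 1, by omega⟩, ⟨t.val - 3, by omega⟩} :
          Finset (Fin N)) ⊆ (rung s t).controls := by
        intro q hq
        simp only [Finset.mem_insert, Finset.mem_singleton, Fin.ext_iff] at hq
        rw [mem_controls_rung]
        omega
      refine le_trans (Finset.card_eq_three.2 ⟨_, _, _, ?_, ?_, ?_, rfl⟩).ge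
        (Finset.card_le_card hsub)
      all_goals
        rw [Ne, Fin.ext_iff]
        dsimp only
        omega
    have hd : (rung s t).controls.card ≤ 2 ^ d :=
      ((Finset.card_le_univ _).trans_eq (Fintype.card_fin N)).trans hN
    obtain ⟨c, hc, hrun⟩ := exists_block (rung s t) ha h3 hd
    refine ⟨c, hc.mono ?_ le_rfl le_rfl, hrun⟩
    rw [Finset.insert_subset_iff]
    refine ⟨Finset.mem_union_right _ (mem_dirtyAncilla.2 ⟨?_, ha⟩), Finset.subset_union_left⟩
    change t.val - 2 + 2 = t.val
    omega
  · obtain rfl : s = 1 := by omega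
    have h2 : (rung 1 t).controls = {⟨t.val - 2, by omega⟩, ⟨t.val - 1, by omega⟩} := by
      ext q
      simp only [mem_controls_rung, Finset.mem_insert, Finset.mem_singleton, Fin.ext_iff]
      omega
    have hT : (rung 1 t).IsToffoliOrX := by
      refine Or.inl ?_
      rw [h2, Finset.card_pair]
      rw [Ne, Fin.ext_iff]
      dsimp only
      omega
    exact ⟨[rung 1 t], (Bounded.singleton hT Finset.subset_union_left).mono le_rfl (by omega)
      (by omega), rfl⟩

theorem of_mem_rungLayer {s r : ℕ} (hs : 0 < s) (hr : r = 0 ∨ r = 2 * s) {g : MCX N}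
    (hg : g ∈ rungLayer N s r) :
    ∃ t : Fin N, 2 * s ≤ t.val ∧ t.val % 2 = 0 ∧ g = rung s t := by
  obtain ⟨t, ⟨ht, h0⟩, rfl⟩ := mem_rungLayer.1 hg
  have h2 := mod_four_mul_mod_two s t.val
  refine ⟨t, ?_, by omega, rfl⟩
  rcases hr with rfl | rfl
  · have := Nat.le_of_dvd h0 (Nat.dvd_of_mod_eq_zero ht)
    omega
  · exact ht.symm.le.trans (Nat.mod_le _ _)

theorem target_ne_of_disjoint {g h : MCX N} (hd : Disjoint g.support h.support) :
    g.target ≠ h.target := fun e =>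
  Finset.disjoint_left.1 hd g.target_mem_support (e ▸ h.target_mem_support)

theorem pairwise_disjoint_dirtyAncilla {l : Circuit N} (hl : IsLayer l) :
    l.Pairwise fun g h => Disjoint (dirtyAncilla g) (dirtyAncilla h) := by
  refine hl.imp fun {g h} hd => Finset.disjoint_left.2 fun q hq hq' => ?_
  rw [mem_dirtyAncilla] at hq hq'
  exact target_ne_of_disjoint hd (Fin.ext (hq.1.symm.trans hq'.1))

/-- The ancilla lies two below its target, while the other supports end at least `4 * s` below that
target or start at least `2 * s` above it. -/
theorem disjoint_dirtyAncilla_support {s r : ℕ} (hs : 0 < s) {g h : MCX N}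
    (hg : g ∈ rungLayer N s r) (hh : h ∈ rungLayer N s r) :
    Disjoint (dirtyAncilla g) h.support := by
  refine Finset.disjoint_left.2 fun q hq hq' => ?_
  rw [mem_dirtyAncilla] at hq
  obtain ⟨t, ⟨ht, -⟩, rfl⟩ := mem_rungLayer.1 hg
  obtain ⟨t', ⟨ht', -⟩, rfl⟩ := mem_rungLayer.1 hh
  have h1 : q.val + 2 = t.val := hq.1
  have h2 := le_of_mem_support_rung hq'
  rcases lt_trichotomy t.val t'.val with hlt | he | hlt
  · have := add_le_of_mod_eq hlt (ht.trans ht'.symm)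
    omega
  · rw [Fin.ext he] at hq
    exact hq.2 hq'
  · have := add_le_of_mod_eq hlt (ht'.trans ht.symm)
    omega

/-- The layers of the ladder, realised with Toffoli and `X` gates. -/
theorem exists_realisation {d k : ℕ} (hd : N ≤ 2 ^ d) (hk : N ≤ 2 ^ k * 2) :
    ∃ R : List (Circuit N), List.Forall₂ RealisesLayer R (ladderLayers N k 1) ∧
      Bounded Finset.univ (2 * k * (40 * d + 20)) (2 * k * (12 * N)) R.flatten ∧
      Circuit.run R.flatten = strideLadder 1 := by
  -- One block is chosen for every gate, empty by default off the rungs, so that the same function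
  -- serves all layers.
  have hblock : ∀ g : MCX N, ∃ c : Circuit N, (∃ s t, 0 < s ∧ 2 * s ≤ t.val ∧ t.val % 2 = 0 ∧
      g = rung s t) → Bounded (g.support ∪ dirtyAncilla g) (40 * d + 20) (12 * g.support.card) c ∧
      c.run = g.act := by
    intro g
    by_cases h : ∃ s t, 0 < s ∧ 2 * s ≤ t.val ∧ t.val % 2 = 0 ∧ g = rung s t
    · obtain ⟨s, t, hs, ht, hev, rfl⟩ := h
      obtain ⟨c, hc⟩ := exists_rung_block hd hs ht hev
      exact ⟨c, fun _ => hc⟩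
    · exact ⟨[], fun h' => absurd h' h⟩
  choose block hblock using hblock
  have hb : ∀ l ∈ ladderLayers N k 1, ∀ g ∈ l,
      Bounded (g.support ∪ dirtyAncilla g) (40 * d + 20) (12 * g.support.card) (block g) ∧
        (block g).run = g.act := by
    intro l hl g hg
    obtain ⟨s, r, hs, hr, rfl⟩ := mem_ladderLayers one_pos hl
    obtain ⟨t, ht, hev, rfl⟩ := of_mem_rungLayer hs hr hg
    exact hblock _ ⟨s, t, hs, ht, hev, rfl⟩
  have hlay : ∀ l ∈ ladderLayers N k 1, l.IsLayer ∧
      ∀ g ∈ l, ∀ h ∈ l, Disjoint (dirtyAncilla g) h.support := by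
    intro l hl
    obtain ⟨s, r, hs, hr, rfl⟩ := mem_ladderLayers one_pos hl
    exact ⟨rungLayer_isLayer s r, fun g hg h hh => disjoint_dirtyAncilla_support hs hg hh⟩
  refine ⟨(ladderLayers N k 1).map fun l => l.flatMap block, ?_, ?_, ?_⟩
  · rw [List.forall₂_map_left_iff, List.forall₂_same]
    intro l hl
    refine ⟨dirtyAncilla, block, rfl, pairwise_disjoint_dirtyAncilla (hlay l hl).1, fun g hg => ?_⟩
    obtain ⟨h₁, h₂⟩ := hb l hl g hg
    refine ⟨(hlay l hl).2 g hg, h₁.isToffoliX, h₁.support_subset, ?_⟩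
    rw [op_eq_basisOp_run, h₂, MCX.op]
  · have := Bounded.flatten (A := Finset.univ) (d := 40 * d + 20) (k := 12 * N)
      (R := (ladderLayers N k 1).map fun l => l.flatMap block) fun c hc => by
        obtain ⟨l, hl, rfl⟩ := List.mem_map.1 hc
        obtain ⟨hl₁, hl₂⟩ := hlay l hl
        refine (Bounded.flatMap (A := fun g => g.support ∪ dirtyAncilla g)
          ((hl₁.and (pairwise_disjoint_dirtyAncilla hl₁)).imp_of_mem
            fun {g h} hg hh ⟨h₁, h₂⟩ => ?_)
          fun g hg => (hb l hl g hg).1).mono le_rfl le_rfl ?_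
        · rw [List.sum_map_mul_left]
          exact Nat.mul_le_mul_left _ hl₁.sum_card_support_le
        · rw [Finset.disjoint_union_left, Finset.disjoint_union_right, Finset.disjoint_union_right]
          exact ⟨⟨h₁, (hl₂ h hh g hg).symm⟩, hl₂ g hg h hh, h₂⟩
    rwa [List.length_map, length_ladderLayers] at this
  · have e : ((ladderLayers N k 1).map fun l => l.flatMap block).flatten =
        (ladderLayers N k 1).flatten.flatMap block := by
      rw [List.flatMap_def, List.map_flatten, List.flatten_flatten, List.map_map]
      rfl
    rw [e, run_flatMap fun g hg => ?_]
    · funext x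
      exact run_ladderLayers one_pos (by omega) x
    · obtain ⟨l, hl, hg⟩ := List.mem_flatten.1 hg
      exact (hb l hl g hg).2

end QCirc

/-! ### The circuits and their asymptotic bounds -/

open QCirc QCirc.Circuit in
theorem mainTheorem4 :
    ∃ (C : (n : ℕ) → QCirc.Circuit (2 * n + 1))
      (L : (n : ℕ) → List (QCirc.Circuit (2 * n + 1))),
      (∀ n, (C n).IsToffoliX) ∧
      (∀ n, (C n).op = QCirc.ladderTwo n) ∧
      (fun n => ((C n).depth : ℝ)) =O[Filter.atTop] (fun n : ℕ => (Real.logb 2 n) ^ 2) ∧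
      (fun n => ((C n).length : ℝ)) =O[Filter.atTop] (fun n : ℕ => (n : ℝ) * Real.logb 2 n) ∧
      (∀ n, (∀ l ∈ L n, QCirc.Circuit.IsLayer l) ∧
        QCirc.Circuit.op (L n).flatten = QCirc.ladderTwo n) ∧
      (fun n => ((L n).length : ℝ)) =O[Filter.atTop] (fun n : ℕ => Real.logb 2 n) ∧
      (∀ n, ∃ R : List (QCirc.Circuit (2 * n + 1)),
        List.Forall₂ QCirc.Circuit.RealisesLayer R (L n) ∧ C n = R.flatten) := by
  have hk : ∀ n : ℕ, 2 * n + 1 ≤ 2 ^ (Nat.log 2 n + 1) * 2 := fun n => by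
    have := Nat.lt_pow_succ_log_self one_lt_two n
    omega
  choose R hR hB hrun using fun n : ℕ =>
    exists_realisation (N := 2 * n + 1) (d := Nat.log 2 n + 2) (k := Nat.log 2 n + 1)
      (by rw [pow_succ]; exact hk n) (hk n)
  have hlog : ∀ᶠ n : ℕ in Filter.atTop, 2 ≤ n ∧ 1 ≤ Nat.log 2 n ∧
      (Nat.log 2 n : ℝ) ≤ Real.logb 2 n := by
    filter_upwards [Filter.eventually_ge_atTop 2] with n hn
    exact ⟨hn, Nat.log_pos one_lt_two hn, by exact_mod_cast Real.natLog_le_logb n 2⟩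
  refine ⟨fun n => (R n).flatten, fun n => ladderLayers (2 * n + 1) (Nat.log 2 n + 1) 1,
    fun n => (hB n).isToffoliX, fun n => ?_, ?_, ?_, fun n => ⟨fun l hl => ?_, ?_⟩, ?_,
    fun n => ⟨R n, hR n, rfl⟩⟩
  · rw [op_eq_basisOp_run, hrun, strideLadder_one, ladderTwo]
  -- With `ℓ = Nat.log 2 n ≥ 1`, the depth bound is `2 (ℓ + 1) (40 (ℓ + 2) + 20) ≤ 4ℓ * 140ℓ`.
  · refine Asymptotics.IsBigO.of_bound 560 ?_
    filter_upwards [hlog] with n ⟨_, h1, hle⟩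
    have h : depth (R n).flatten ≤ 560 * Nat.log 2 n ^ 2 :=
      (depth_le (hB n).depthLE).trans (by nlinarith)
    rw [Real.norm_of_nonneg (by positivity), Real.norm_of_nonneg (by positivity)]
    calc ((depth (R n).flatten : ℕ) : ℝ) ≤ 560 * (Nat.log 2 n : ℝ) ^ 2 := by exact_mod_cast h
      _ ≤ 560 * Real.logb 2 n ^ 2 := by gcongr
  · refine Asymptotics.IsBigO.of_bound 144 ?_
    filter_upwards [hlog] with n ⟨h2, h1, hle⟩
    have h : (R n).flatten.length ≤ 144 * (n * Nat.log 2 n) := (hB n).length_le.trans (by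
      calc 2 * (Nat.log 2 n + 1) * (12 * (2 * n + 1))
          ≤ 2 * (2 * Nat.log 2 n) * (12 * (3 * n)) := by gcongr <;> omega
        _ = 144 * (n * Nat.log 2 n) := by ring)
    rw [Real.norm_of_nonneg (by positivity),
      Real.norm_of_nonneg (mul_nonneg (Nat.cast_nonneg n) ((Nat.cast_nonneg _).trans hle))]
    calc ((R n).flatten.length : ℝ) ≤ 144 * (n * (Nat.log 2 n : ℝ)) := by exact_mod_cast h
      _ ≤ 144 * (n * Real.logb 2 n) := by gcongr
  · obtain ⟨s, r, -, -, rfl⟩ := mem_ladderLayers one_pos hl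
    exact rungLayer_isLayer s r
  · rw [op_eq_basisOp_run, ladderTwo, ← strideLadder_one]
    congr 1
    funext x
    exact run_ladderLayers one_pos ((hk n).trans (by omega)) x
  · refine Asymptotics.IsBigO.of_bound 4 ?_
    filter_upwards [hlog] with n ⟨_, h1, hle⟩
    have h : 2 * (Nat.log 2 n + 1) ≤ 4 * Nat.log 2 n := by omega
    rw [length_ladderLayers, Real.norm_of_nonneg (by positivity),
      Real.norm_of_nonneg ((Nat.cast_nonneg _).trans hle)]
    calc ((2 * (Nat.log 2 n + 1) : ℕ) : ℝ) ≤ 4 * (Nat.log 2 n : ℝ) := by exact_mod_cast h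
      _ ≤ 4 * Real.logb 2 n := by gcongr
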